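/- Let $d\ge 1$, let $z\in\mathbb R^d$ satisfy $\|z\|_2=1$ and the $\mu$-incoherence condition $\|z\|_\infty\le \mu/\sqrt d$, and let $M=zz^\top$. Let $\Omega\subseteq[d]\times[d]$ be the random set of observed entries: independently for every unordered pair $\{i,j\}$ (with $i=j$ allowed), with probability $p$ both $(i,j)$ and $(j,i)$ belong to $\Omega$, and otherwise neither does. For a matrix $A$ let $P_\Omega(A)$ be the matrix obtained from $A$ by zeroing out all entries outside $\Omega$, and let $$f(x)=\tfrac12\big\|P_\Omega(M-xx^\top)\big\|_F^2,\qquad \mathcal B=\Big\{x\in\mathbb R^d:\ \|x\|_\infty<\frac{2\mu}{\sqrt d}\Big\}.$$ There is a universal constant $C>0$ such that for every $k\in\mathbb N$ there is a real polynomial $P_k$ in two variables for which the following holds for all $d$, $\mu$, $z$ as above, all $\epsilon>0$ and all $p\in[0,1]$ with $$p\ \ge\ \frac{P_k(\mu,\log d)}{d\,\epsilon^2}.$$ With probability at least $1-d^{-k}$ over the choice of $\Omega$, every local minimum $x$ of $f:\mathbb R^d\to\mathbb R$ that lies in $\mathcal B$ satisfies $$\|x-z\|_2\le C\sqrt\epsilon\qquad\text{or}\qquad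 \|x+z\|_2\le C\sqrt\epsilon .$$ -/

import Mathlib

/-- The set `Ω ⊆ [d] × [d]` of observed entries determined by a set of unordered index pairs
(a pair `s(i, i)` stands for the diagonal entry `(i, i)`): the entries `(i, j)` and `(j, i)` are
either both observed or both unobserved. -/
def observedEntries {d : ℕ} (S : Set (Sym2 (Fin d))) : Set (Fin d × Fin d) :=
  {q | s(q.1, q.2) ∈ S}

/-- `P_Ω(A)`: the matrix obtained from `A` by zeroing out all the entries not in `Ω`. -/
noncomputable def entryProj {d : ℕ} (Ω : Set (Fin d × Fin d)) (A : Matrix (Fin d) (Fin d) ℝ) :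
    Matrix (Fin d) (Fin d) ℝ :=
  Matrix.of fun i j => Ω.indicator (fun q => A q.1 q.2) (i, j)

section FrobeniusNorm

attribute [local instance] Matrix.frobeniusNormedAddCommGroup

/-- The matrix completion objective `f(x) = ½ ‖P_Ω(M - x xᵀ)‖_F²` (the norm is the Frobenius
norm). -/
noncomputable def completionObjective {d : ℕ} (Ω : Set (Fin d × Fin d))
    (M : Matrix (Fin d) (Fin d) ℝ) (x : EuclideanSpace ℝ (Fin d)) : ℝ :=
  1 / 2 * ‖entryProj Ω (M - Matrix.vecMulVec x.ofLp x.ofLp)‖ ^ 2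

end FrobeniusNorm

/-- The incoherent ball `B = {x : ‖x‖_∞ < 2 μ / √d}` (the norm of `x.ofLp : Fin d → ℝ` is the
sup norm). -/
def incoherentBall (d : ℕ) (μ : ℝ) : Set (EuclideanSpace ℝ (Fin d)) :=
  {x | ‖x.ofLp‖ < 2 * μ / √(d : ℝ)}

/-- The law of the random set `Ω` of observed entries, as a law on sets of unordered index pairs:
every pair, diagonal ones included, is observed independently with probability `p`. -/
noncomputable def observationLaw (d : ℕ) (p : unitInterval) :
    MeasureTheory.Measure (Set (Sym2 (Fin d))) :=
  ProbabilityTheory.setBernoulli Set.univ p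

/-! Along a line `x + t • v` the objective is a quartic in `t`. A local minimum gives two
first-order identities (`v = x`, `v = z`) and one curvature inequality (`v = z`). All three combine
values `obsForm S a b` where `a`, `b` are among the entrywise products `x∘x`, `x∘z`, `z∘z`, whose
entries are at most `4μ²/d`. If every such value is within `pε` of its mean `p (∑ a) (∑ b)`, then `s
= ‖x‖²` and `c = ⟪x, z⟫` satisfy `c² ≈ s²`, `c (1 - s) ≈ 0` and `s + 2c² ≳ 1`. The first two leave
only `x` near `0` or `±z`; the curvature excludes `0` (`near_unit_of_conditions`).

Uniformity over `x` costs little: a bilinear form on a cube is dominated by its values at sign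
vectors, so a Chernoff bound and a union over `4^d` pairs suffice (`obsDeviation_uniform`). -/

open MeasureTheory ProbabilityTheory

/-! ### Exponential moments and the Chernoff bound -/

/-- Under a Bernoulli random set, expectations of products over the ground set factorize. -/
theorem integral_setBernoulli_prod {ι : Type*} [Fintype ι] [DecidableEq ι] (p : unitInterval)
    (a b : ι → ℝ) :
    ∫ S, (∏ e, (S.indicator a e + Sᶜ.indicator b e)) ∂(setBernoulli (Set.univ : Set ι) p) =
      ∏ e, ((p : ℝ) * a e + (1 - p) * b e) := by
  classical
  rw [integral_fintype .of_finite, Finset.prod_add, ← (Fintype.finsetEquivSet (α := ι)).sum_comp,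
    Finset.powerset_univ]
  refine Finset.sum_congr rfl fun T _ => ?_
  have hT : ∏ e, ((T : Set ι).indicator a e + (T : Set ι)ᶜ.indicator b e) =
      (∏ e ∈ T, a e) * ∏ e ∈ Finset.univ \ T, b e := by
    rw [← Finset.prod_mul_prod_compl T, ← Finset.compl_eq_univ_sdiff]
    congr 1 <;> refine Finset.prod_congr rfl fun e he => ?_
    · simp [he]
    · simp [Finset.mem_compl.1 he]
  have hc : ((Set.univ : Set ι) \ (T : Set ι)).ncard = (Finset.univ \ T).card := by
    rw [← Set.ncard_coe_finset]; simp
  rw [Fintype.finsetEquivSet_apply, setBernoulli_real_singleton p (Set.subset_univ _)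
    Set.finite_univ, hT, Set.ncard_coe_finset, hc, Finset.prod_mul_distrib,
    Finset.prod_mul_distrib, Finset.prod_const, Finset.prod_const, smul_eq_mul]
  ring

/-- Moment generating function bound for a centred Bernoulli variable. -/
theorem bernoulli_mgf_le {p y : ℝ} (hp : 0 ≤ p) (hy : |y| ≤ 1) :
    p * Real.exp ((1 - p) * y) + (1 - p) * Real.exp (-p * y) ≤ Real.exp (p * y ^ 2) := by
  have h1 : Real.exp y ≤ 1 + y + y ^ 2 := by
    have := (abs_le.1 (Real.abs_exp_sub_one_sub_id_le hy)).2
    linarith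
  have h2 : p * Real.exp ((1 - p) * y) + (1 - p) * Real.exp (-p * y) =
      Real.exp (-p * y) * (1 + p * (Real.exp y - 1)) := by
    rw [show (1 - p) * y = -p * y + y by ring, Real.exp_add]
    ring
  rw [h2, show p * y ^ 2 = -p * y + p * (y + y ^ 2) by ring, Real.exp_add]
  refine mul_le_mul_of_nonneg_left ?_ (Real.exp_pos _).le
  have h3 := Real.add_one_le_exp (p * (y + y ^ 2))
  have h4 : p * (Real.exp y - 1) ≤ p * (y + y ^ 2) :=
    mul_le_mul_of_nonneg_left (by linarith) hp
  linarith

/-- Chernoff bound for weighted sums of centred Bernoulli variables. -/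
theorem setBernoulli_chernoff {ι : Type*} [Fintype ι] (p : unitInterval) (g : ι → ℝ) {l : ℝ}
    (t : ℝ) (hl : 0 ≤ l) (hg : ∀ e, |l * g e| ≤ 1) :
    (setBernoulli (Set.univ : Set ι) p).real {S | t ≤ ∑ e, (S.indicator 1 e - (p : ℝ)) * g e} ≤
      Real.exp (-l * t + p * l ^ 2 * ∑ e, g e ^ 2) := by
  classical
  refine (measure_ge_le_exp_mul_mgf t hl .of_finite).trans ?_
  rw [Real.exp_add]
  refine mul_le_mul_of_nonneg_left ?_ (Real.exp_pos _).le
  have h1 : ∀ S : Set ι, Real.exp (l * ∑ e, (S.indicator 1 e - (p : ℝ)) * g e) =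
      ∏ e, (S.indicator (fun e => Real.exp ((1 - p) * (l * g e))) e +
        Sᶜ.indicator (fun e => Real.exp (-p * (l * g e))) e) := by
    intro S
    rw [Finset.mul_sum, Real.exp_sum]
    refine Finset.prod_congr rfl fun e _ => ?_
    by_cases he : e ∈ S <;> simp [he] <;> ring
  simp only [mgf, h1]
  rw [integral_setBernoulli_prod, Finset.mul_sum, Real.exp_sum]
  refine Finset.prod_le_prod (fun e _ => ?_) fun e _ => ?_
  · have := p.2.1
    have := p.2.2
    have : 0 ≤ 1 - (p : ℝ) := by linarith
    positivity
  · refine (bernoulli_mgf_le p.2.1 (hg e)).trans_eq ?_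
    ring_nf

/-! ### Uniform concentration of the observation form -/

/-- The centred bilinear form of the observation pattern. -/
noncomputable def obsDeviation {d : ℕ} (p : ℝ) (S : Set (Sym2 (Fin d))) (a b : Fin d → ℝ) : ℝ :=
  ∑ i, ∑ j, (S.indicator 1 s(i, j) - p) * (a i * b j)

/-- One coin governs at most two matrix entries, so its weight in the deviation form is at most 2.
-/
theorem card_sym2_fiber_le {d : ℕ} (e : Sym2 (Fin d)) :
    (Finset.univ.filter fun q : Fin d × Fin d => s(q.1, q.2) = e).card ≤ 2 := by
  induction e with
  | h x y =>
    refine (Finset.card_le_card (t := {(x, y), (y, x)}) ?_).trans Finset.card_le_two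
    rintro ⟨u, v⟩ h
    simpa using h

/-- Tail bound for the deviation form at a pair of vectors bounded by one. -/
theorem obsDeviation_tail {d : ℕ} (p : unitInterval) {η : ℝ} (hη : 0 ≤ η) (hη2 : η ≤ 2)
    (a b : Fin d → ℝ) (ha : ∀ i, |a i| ≤ 1) (hb : ∀ i, |b i| ≤ 1) :
    (observationLaw d p).real {S | η * p * d ^ 2 ≤ obsDeviation p S a b} ≤
      Real.exp (-(η ^ 2 * p * d ^ 2 / 8)) := by
  classical
  let F : Sym2 (Fin d) → Finset (Fin d × Fin d) :=
    fun e => Finset.univ.filter fun q : Fin d × Fin d => s(q.1, q.2) = e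
  let g : Sym2 (Fin d) → ℝ := fun e => ∑ q ∈ F e, a q.1 * b q.2
  have hF : ∀ e, ((F e).card : ℝ) ≤ 2 := fun e => by exact_mod_cast card_sym2_fiber_le e
  have hgF : ∀ e, |g e| ≤ (F e).card := fun e => by
    refine (Finset.abs_sum_le_sum_abs _ _).trans ?_
    refine (Finset.sum_le_card_nsmul _ _ 1 fun q _ => ?_).trans_eq (by simp)
    rw [abs_mul]
    exact mul_le_one₀ (ha _) (abs_nonneg _) (hb _)
  have hsum : ∑ e, g e ^ 2 ≤ 2 * (d : ℝ) ^ 2 := by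
    have hcard : ∑ e, ((F e).card : ℝ) = (d : ℝ) ^ 2 := by
      have := Finset.card_eq_sum_card_fiberwise (s := (Finset.univ : Finset (Fin d × Fin d)))
        (t := Finset.univ) (f := fun q => s(q.1, q.2)) (by simp)
      rw [← Nat.cast_sum, ← this]
      simp [sq]
    rw [← hcard, Finset.mul_sum]
    refine Finset.sum_le_sum fun e _ => ?_
    rw [← sq_abs, sq]
    exact mul_le_mul ((hgF e).trans (hF e)) (hgF e) (abs_nonneg _) zero_le_two
  have hrw : ∀ S, obsDeviation p S a b = ∑ e, (S.indicator 1 e - (p : ℝ)) * g e := by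
    intro S
    rw [obsDeviation, ← Fintype.sum_prod_type' (f := fun i j =>
      (S.indicator 1 s(i, j) - (p : ℝ)) * (a i * b j)),
      ← Finset.sum_fiberwise (g := fun q : Fin d × Fin d => s(q.1, q.2))]
    refine Finset.sum_congr rfl fun e _ => ?_
    rw [Finset.mul_sum]
    refine Finset.sum_congr rfl fun q hq => ?_
    rw [(Finset.mem_filter.1 hq).2]
  simp only [hrw]
  -- `l = η/4` minimises `-lη + 2l²`, with value `-η²/8`; `|g e| ≤ 2` and `η ≤ 2` keep `|l * g e| ≤
  -- 1`.
  refine (setBernoulli_chernoff p g (l := η / 4) _ (by positivity) fun e => ?_).trans ?_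
  · rw [abs_mul, abs_of_nonneg (by positivity)]
    have := mul_le_mul (show η / 4 ≤ 1 / 2 by linarith) ((hgF e).trans (hF e)) (abs_nonneg _)
      (by norm_num)
    linarith
  · refine Real.exp_le_exp.2 ?_
    have := mul_le_mul_of_nonneg_left hsum
      (show 0 ≤ (p : ℝ) * (η / 4) ^ 2 from mul_nonneg p.2.1 (sq_nonneg _))
    linarith

/-- A sign vector. -/
def signVec {d : ℕ} (s : Fin d → Bool) (i : Fin d) : ℝ := if s i then 1 else -1

theorem abs_signVec {d : ℕ} (s : Fin d → Bool) (i : Fin d) : |signVec s i| ≤ 1 := by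
  unfold signVec; split <;> simp

/-- A linear form on the cube is dominated by its value at a sign vector. -/
theorem exists_signVec {d : ℕ} (c : Fin d → ℝ) :
    ∃ s : Fin d → Bool, ∀ B : ℝ, ∀ a : Fin d → ℝ, (∀ i, |a i| ≤ B) →
      |∑ i, a i * c i| ≤ B * ∑ i, signVec s i * c i := by
  classical
  refine ⟨fun i => decide (0 ≤ c i), fun B a ha => ?_⟩
  refine (Finset.abs_sum_le_sum_abs _ _).trans ?_
  rw [Finset.mul_sum]
  refine Finset.sum_le_sum fun i _ => ?_
  have : signVec (fun i => decide (0 ≤ c i)) i * c i = |c i| := by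
    by_cases h : 0 ≤ c i
    · simp [signVec, h, abs_of_nonneg h]
    · simp [signVec, h, abs_of_neg (not_le.1 h)]
  rw [this, abs_mul]
  exact mul_le_mul_of_nonneg_right (ha i) (abs_nonneg _)

/-- The deviation form on a cube is dominated by its values at pairs of sign vectors. -/
theorem abs_obsDeviation_le {d : ℕ} {p : ℝ} {S : Set (Sym2 (Fin d))} {T : ℝ}
    (h : ∀ s t : Fin d → Bool, obsDeviation p S (signVec s) (signVec t) ≤ T) {B : ℝ} (hB : 0 ≤ B)
    {a b : Fin d → ℝ} (ha : ∀ i, |a i| ≤ B) (hb : ∀ i, |b i| ≤ B) :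
    |obsDeviation p S a b| ≤ B ^ 2 * T := by
  have h1 : ∀ a b : Fin d → ℝ, obsDeviation p S a b =
      ∑ i, a i * ∑ j, (S.indicator 1 s(i, j) - p) * b j := by
    intro a b
    refine Finset.sum_congr rfl fun i _ => ?_
    rw [Finset.mul_sum]
    exact Finset.sum_congr rfl fun j _ => by ring
  have h2 : ∀ a b : Fin d → ℝ, obsDeviation p S a b =
      ∑ j, b j * ∑ i, (S.indicator 1 s(i, j) - p) * a i := by
    intro a b
    rw [obsDeviation, Finset.sum_comm]
    refine Finset.sum_congr rfl fun i _ => ?_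
    rw [Finset.mul_sum]
    exact Finset.sum_congr rfl fun j _ => by ring
  -- Round one argument at a time: `s` depends on `b`, then `t` on `s`.
  obtain ⟨s, hs⟩ := exists_signVec fun i => ∑ j, (S.indicator 1 s(i, j) - p) * b j
  obtain ⟨t, ht⟩ := exists_signVec fun j => ∑ i, (S.indicator 1 s(i, j) - p) * signVec s i
  have e1 := hs B a ha
  have e2 := ht B b hb
  rw [← h1] at e1
  rw [← h1] at e1
  rw [← h2] at e2
  rw [← h2] at e2
  calc |obsDeviation p S a b| ≤ B * obsDeviation p S (signVec s) b := e1
    _ ≤ B * (B * T) := mul_le_mul_of_nonneg_left ((le_abs_self _).trans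
        (e2.trans (mul_le_mul_of_nonneg_left (h s t) hB))) hB
    _ = B ^ 2 * T := by ring

/-- With high probability the deviation form is uniformly small at all pairs of sign vectors. -/
theorem obsDeviation_uniform {d k : ℕ} (hd : 1 ≤ d) (p : unitInterval) {η : ℝ} (hη : 0 ≤ η)
    (hη2 : η ≤ 2) (hp : 8 * (2 + k * Real.log d) ≤ η ^ 2 * p * d) :
    1 - 1 / (d : ℝ) ^ k ≤ (observationLaw d p).real {S | ∀ s t : Fin d → Bool,
      obsDeviation p S (signVec s) (signVec t) ≤ η * p * d ^ 2} := by
  have : IsProbabilityMeasure (observationLaw d p) := by unfold observationLaw; infer_instance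
  have hd0 : (0 : ℝ) < d := by exact_mod_cast hd
  have hd1 : (1 : ℝ) ≤ d := by exact_mod_cast hd
  set G := {S : Set (Sym2 (Fin d)) | ∀ s t : Fin d → Bool,
      obsDeviation p S (signVec s) (signVec t) ≤ η * p * d ^ 2} with hG
  have hc := probReal_add_probReal_compl (μ := observationLaw d p) (s := G) (Set.toFinite G).measurableSet
  have hsub : Gᶜ ⊆ ⋃ q : (Fin d → Bool) × (Fin d → Bool),
      {S | η * p * d ^ 2 ≤ obsDeviation p S (signVec q.1) (signVec q.2)} := by
    intro S hS
    simp only [hG, Set.mem_compl_iff, Set.mem_ofPred_eq, not_forall, not_le] at hS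
    obtain ⟨s, t, h⟩ := hS
    exact Set.mem_iUnion.2 ⟨(s, t), h.le⟩
  have hb : (observationLaw d p).real Gᶜ ≤ 1 / (d : ℝ) ^ k := by
    refine (measureReal_mono hsub).trans ((measureReal_iUnion_fintype_le _).trans ?_)
    refine (Finset.sum_le_card_nsmul _ _ _ fun q _ => obsDeviation_tail p hη hη2 _ _
      (abs_signVec q.1) (abs_signVec q.2)).trans ?_
    -- The `4^d` sign pairs cost at most `exp (2d)`, which the 2 in `hp` absorbs.
    have h4 : (4 : ℝ) ≤ Real.exp 2 := by
      have := Real.exp_one_gt_d9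
      rw [show (2 : ℝ) = 1 + 1 by norm_num, Real.exp_add]
      nlinarith
    have hcard : ((Finset.univ : Finset ((Fin d → Bool) × (Fin d → Bool))).card : ℝ) ≤
        Real.exp (d * 2) := by
      rw [Real.exp_nat_mul]
      refine le_trans (le_of_eq ?_) (pow_le_pow_left₀ (by norm_num) h4 d)
      simp [← mul_pow]
    rw [nsmul_eq_mul, one_div, ← Real.exp_log (pow_pos hd0 k), ← Real.exp_neg, Real.log_pow]
    refine (mul_le_mul_of_nonneg_right hcard (Real.exp_pos _).le).trans ?_
    rw [← Real.exp_add]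
    refine Real.exp_le_exp.2 ?_
    have h5 := mul_le_mul_of_nonneg_right hp hd0.le
    have h6 : (k : ℝ) * Real.log d ≤ (k * Real.log d) * d :=
      le_mul_of_one_le_right (mul_nonneg k.cast_nonneg (Real.log_nonneg hd1)) hd1
    nlinarith
  linarith

/-! ### Optimality conditions along lines -/

/-- Necessary conditions of first and second order for a quartic polynomial at a local minimum. -/
theorem quartic_isLocalMin {e A B C D : ℝ}
    (h : IsLocalMin (fun t : ℝ => e + A * t + B * t ^ 2 + C * t ^ 3 + D * t ^ 4) 0) :
    A = 0 ∧ 0 ≤ B := by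
  have hder : HasDerivAt (fun t : ℝ => e + A * t + B * t ^ 2 + C * t ^ 3 + D * t ^ 4) A 0 := by
    have h1 := (((((hasDerivAt_const (0 : ℝ) e).add ((hasDerivAt_id (0 : ℝ)).const_mul A)).add
      ((hasDerivAt_pow 2 (0 : ℝ)).const_mul B)).add
      ((hasDerivAt_pow 3 (0 : ℝ)).const_mul C)).add ((hasDerivAt_pow 4 (0 : ℝ)).const_mul D))
    exact h1.congr_deriv (by simp)
  have hA : A = 0 := h.hasDerivAt_eq_zero hder
  subst hA
  refine ⟨rfl, ?_⟩
  -- Once `A = 0`, this is the increment of the quartic divided by `t²`.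
  have hlim : Filter.Tendsto (fun t : ℝ => B + C * t + D * t ^ 2) (nhdsWithin 0 {0}ᶜ) (nhds B) := by
    have : Continuous fun t : ℝ => B + C * t + D * t ^ 2 := by fun_prop
    simpa using (this.tendsto 0).mono_left nhdsWithin_le_nhds
  refine ge_of_tendsto hlim ?_
  filter_upwards [nhdsWithin_le_nhds h, self_mem_nhdsWithin] with t ht ht0
  have ht1 : 0 < t ^ 2 := by have : t ≠ 0 := ht0; positivity
  have ht2 : 0 ≤ t ^ 2 * (B + C * t + D * t ^ 2) := by
    have ht' : e + 0 * 0 + B * 0 ^ 2 + C * 0 ^ 3 + D * 0 ^ 4 ≤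
        e + 0 * t + B * t ^ 2 + C * t ^ 3 + D * t ^ 4 := ht
    linarith
  exact nonneg_of_mul_nonneg_right ht2 ht1

/-- The bilinear form of the observation pattern. -/
noncomputable def obsForm {d : ℕ} (S : Set (Sym2 (Fin d))) (a b : Fin d → ℝ) : ℝ :=
  ∑ i, ∑ j, S.indicator 1 s(i, j) * (a i * b j)

theorem obsForm_eq {d : ℕ} (p : ℝ) (S : Set (Sym2 (Fin d))) (a b : Fin d → ℝ) :
    obsForm S a b = obsDeviation p S a b + p * ((∑ i, a i) * ∑ j, b j) := by
  rw [Finset.sum_mul_sum, Finset.mul_sum, obsForm, obsDeviation, ← Finset.sum_add_distrib]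
  refine Finset.sum_congr rfl fun i _ => ?_
  rw [Finset.mul_sum, ← Finset.sum_add_distrib]
  exact Finset.sum_congr rfl fun j _ => by ring

theorem completionObjective_eq {d : ℕ} (S : Set (Sym2 (Fin d))) (M : Matrix (Fin d) (Fin d) ℝ)
    (x : EuclideanSpace ℝ (Fin d)) :
    completionObjective (observedEntries S) M x =
      1 / 2 * ∑ i, ∑ j, S.indicator 1 s(i, j) * (M i j - x i * x j) ^ 2 := by
  let _ := Matrix.frobeniusNormedAddCommGroup (m := Fin d) (n := Fin d) (α := ℝ)
  have hn : ∀ A : Matrix (Fin d) (Fin d) ℝ, ‖A‖ ^ 2 = ∑ i, ∑ j, A i j ^ 2 := by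
    intro A
    have h0 : 0 ≤ ∑ i, ∑ j, A i j ^ 2 :=
      Finset.sum_nonneg fun i _ => Finset.sum_nonneg fun j _ => sq_nonneg _
    rw [Matrix.frobenius_norm_def, ← Real.sqrt_eq_rpow]
    simp [Real.sq_sqrt h0]
  rw [completionObjective, hn]
  congr 1
  refine Finset.sum_congr rfl fun i _ => Finset.sum_congr rfl fun j _ => ?_
  by_cases h : s(i, j) ∈ S <;>
    simp [entryProj, observedEntries, Set.indicator, h, Matrix.vecMulVec_apply]

/-- First and second order conditions at a local minimum of the completion objective. -/
theorem completionObjective_conditions {d : ℕ} {S : Set (Sym2 (Fin d))}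
    {z x : EuclideanSpace ℝ (Fin d)}
    (h : IsLocalMin
      (completionObjective (observedEntries S) (Matrix.vecMulVec z.ofLp z.ofLp)) x)
    (v : EuclideanSpace ℝ (Fin d)) :
    ∑ i, ∑ j, S.indicator 1 s(i, j) * ((z i * z j - x i * x j) * (x i * v j + v i * x j)) = 0 ∧
    0 ≤ ∑ i, ∑ j, S.indicator 1 s(i, j) *
      ((x i * v j + v i * x j) ^ 2 / 2 - (z i * z j - x i * x j) * (v i * v j)) := by
  have hcont : ContinuousAt (fun t : ℝ => x + t • v) 0 := by fun_prop
  have h' : IsLocalMin (completionObjective (observedEntries S)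
      (Matrix.vecMulVec z.ofLp z.ofLp)) (x + (0 : ℝ) • v) := by simpa using h
  have h2 := h'.comp_continuous (g := fun t : ℝ => x + t • v) hcont
  have key : (completionObjective (observedEntries S)
      (Matrix.vecMulVec z.ofLp z.ofLp)) ∘ (fun t : ℝ => x + t • v) = fun t : ℝ =>
      completionObjective (observedEntries S) (Matrix.vecMulVec z.ofLp z.ofLp) x +
      (-∑ i, ∑ j, S.indicator 1 s(i, j) *
        ((z i * z j - x i * x j) * (x i * v j + v i * x j))) * t +
      (∑ i, ∑ j, S.indicator 1 s(i, j) *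
        ((x i * v j + v i * x j) ^ 2 / 2 - (z i * z j - x i * x j) * (v i * v j))) * t ^ 2 +
      (∑ i, ∑ j, S.indicator 1 s(i, j) * ((x i * v j + v i * x j) * (v i * v j))) * t ^ 3 +
      (∑ i, ∑ j, S.indicator 1 s(i, j) * ((v i * v j) ^ 2 / 2)) * t ^ 4 := by
    funext t
    simp only [Function.comp, completionObjective_eq, Matrix.vecMulVec_apply, PiLp.add_apply,
      PiLp.smul_apply, smul_eq_mul, ← Finset.sum_neg_distrib, Finset.sum_mul, Finset.mul_sum,
      ← Finset.sum_add_distrib]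
    refine Finset.sum_congr rfl fun i _ => Finset.sum_congr rfl fun j _ => ?_
    ring
  rw [key] at h2
  obtain ⟨hA, hB⟩ := quartic_isLocalMin h2
  exact ⟨neg_eq_zero.1 hA, hB⟩

/-! ### From the conditions to closeness -/

/-- The scalar inequalities satisfied by `s = ‖x‖²` and `c = ⟪x, z⟫` pin `x` down up to sign. -/
theorem near_unit_of_conditions {s c e : ℝ} (he : 0 < e) (hs : 0 ≤ s) (hcs : c ^ 2 ≤ s)
    (h1 : |c ^ 2 - s ^ 2| ≤ 2 * e) (h2 : |c * (1 - s)| ≤ 2 * e) (h3 : 1 - 6 * e ≤ s + 2 * c ^ 2) :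
    s - 2 * |c| + 1 ≤ 600 * e := by
  rw [abs_le] at h1
  have hc0 := abs_nonneg c
  -- For large `e`, boundedness of `s` is enough. For small `e`, `h3` keeps `s` and hence `|c|` away
  -- from 0, so `h2` can be divided by `|c|`.
  rcases le_or_gt (1 / 100) e with hl | hl
  · have : s ≤ 1 + 2 * e := by nlinarith
    linarith
  · have hs3 : 3 / 10 ≤ s := by nlinarith
    have hca : |c| ^ 2 = c ^ 2 := sq_abs c
    have hc : 1 / 4 ≤ |c| := by nlinarith
    rw [abs_mul] at h2
    have hs1 : |1 - s| ≤ 8 * e := by nlinarith [abs_nonneg (1 - s)]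
    rw [abs_le] at hs1
    have hc2 : 1 - 18 * e ≤ |c| ^ 2 := by nlinarith
    have hc3 : 1 - 18 * e ≤ |c| := by nlinarith
    linarith

/-- If the observation form is close to its mean on the relevant cube, then every local minimum in
the cube is close to `z` or `-z`. -/
theorem close_of_isLocalMin {d : ℕ} {S : Set (Sym2 (Fin d))} {z x : EuclideanSpace ℝ (Fin d)}
    {p ε m : ℝ} (hε : 0 < ε) (hp : 0 < p) (hz : ‖z‖ = 1) (hzm : ∀ i, |z i| ≤ m)
    (hxm : ∀ i, |x i| ≤ m)
    (hS : ∀ a b : Fin d → ℝ, (∀ i, |a i| ≤ m ^ 2) → (∀ i, |b i| ≤ m ^ 2) →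
      |obsDeviation p S a b| ≤ p * ε)
    (h : IsLocalMin
      (completionObjective (observedEntries S) (Matrix.vecMulVec z.ofLp z.ofLp)) x) :
    ‖x - z‖ ≤ 30 * √ε ∨ ‖x - (-z)‖ ≤ 30 * √ε := by
  have hxx : ∑ i, x i * x i = ‖x‖ ^ 2 := by
    rw [EuclideanSpace.real_norm_sq_eq]; exact Finset.sum_congr rfl fun i _ => (sq _).symm
  have hzz : ∑ i, z i * z i = 1 := by
    rw [← one_pow 2, ← hz, EuclideanSpace.real_norm_sq_eq]
    exact Finset.sum_congr rfl fun i _ => (sq _).symm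
  have hxz : ∑ i, x i * z i = inner ℝ x z := by
    simp [PiLp.inner_apply, mul_comm]
  have hbd : ∀ u v : Fin d → ℝ, (∀ i, |u i| ≤ m) → (∀ i, |v i| ≤ m) →
      ∀ i, |u i * v i| ≤ m ^ 2 := fun u v hu hv i => by
    rw [abs_mul, sq]
    exact mul_le_mul (hu i) (hv i) (abs_nonneg _) ((abs_nonneg _).trans (hu i))
  set s := ‖x‖ ^ 2
  set c := inner ℝ x z with hcdef
  have hcs : c ^ 2 ≤ s := by
    rw [← sq_abs]
    exact pow_le_pow_left₀ (abs_nonneg _) (by simpa [hz] using abs_real_inner_le_norm x z) 2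
  have bx := hbd x x hxm hxm
  have bz := hbd z z hzm hzm
  have bc := hbd x z hxm hzm
  have E : ∀ a b : Fin d → ℝ, (∀ i, |a i| ≤ m ^ 2) → (∀ i, |b i| ≤ m ^ 2) →
      |obsForm S a b - p * ((∑ i, a i) * ∑ j, b j)| ≤ p * ε := fun a b ha hb => by
    rw [obsForm_eq p]
    simpa using hS a b ha hb
  obtain ⟨f1, -⟩ := completionObjective_conditions h x
  obtain ⟨f2, f3⟩ := completionObjective_conditions h z
  have g1 : obsForm S (fun i => x i * z i) (fun i => x i * z i) =
      obsForm S (fun i => x i * x i) (fun i => x i * x i) := by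
    rw [← sub_eq_zero, ← mul_right_inj' (two_ne_zero' ℝ), mul_zero, ← f1]
    simp only [obsForm, ← Finset.sum_sub_distrib, Finset.mul_sum]
    refine Finset.sum_congr rfl fun i _ => Finset.sum_congr rfl fun j _ => ?_
    ring
  have g2 : obsForm S (fun i => x i * z i) (fun i => z i * z i) +
      obsForm S (fun i => z i * z i) (fun i => x i * z i) =
      obsForm S (fun i => x i * x i) (fun i => x i * z i) +
      obsForm S (fun i => x i * z i) (fun i => x i * x i) := by
    rw [← sub_eq_zero, ← f2]
    simp only [obsForm, ← Finset.sum_sub_distrib, ← Finset.sum_add_distrib]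
    refine Finset.sum_congr rfl fun i _ => Finset.sum_congr rfl fun j _ => ?_
    ring
  have g3 : 0 ≤ 1 / 2 * obsForm S (fun i => x i * x i) (fun i => z i * z i) +
      1 / 2 * obsForm S (fun i => z i * z i) (fun i => x i * x i) +
      2 * obsForm S (fun i => x i * z i) (fun i => x i * z i) -
      obsForm S (fun i => z i * z i) (fun i => z i * z i) := by
    refine f3.trans_eq ?_
    simp only [obsForm, ← Finset.sum_sub_distrib, ← Finset.sum_add_distrib, Finset.mul_sum]
    refine Finset.sum_congr rfl fun i _ => Finset.sum_congr rfl fun j _ => ?_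
    ring
  have e1 := abs_le.1 (E _ _ bc bc)
  have e2 := abs_le.1 (E _ _ bx bx)
  have e3 := abs_le.1 (E _ _ bc bz)
  have e4 := abs_le.1 (E _ _ bz bc)
  have e5 := abs_le.1 (E _ _ bx bc)
  have e6 := abs_le.1 (E _ _ bc bx)
  have e7 := abs_le.1 (E _ _ bx bz)
  have e8 := abs_le.1 (E _ _ bz bx)
  have e9 := abs_le.1 (E _ _ bz bz)
  simp only [hxx, hzz, hxz] at e1 e2 e3 e4 e5 e6 e7 e8 e9
  have i1 : |c ^ 2 - s ^ 2| ≤ 2 * ε := by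
    rw [abs_le]
    constructor <;> refine le_of_mul_le_mul_left ?_ hp <;> linarith
  have i2 : |c * (1 - s)| ≤ 2 * ε := by
    rw [abs_le]
    constructor <;> refine le_of_mul_le_mul_left ?_ hp <;> linarith
  have i3 : 1 - 6 * ε ≤ s + 2 * c ^ 2 := by
    refine le_of_mul_le_mul_left ?_ hp
    linarith [mul_pos hp hε]
  have key := near_unit_of_conditions hε (sq_nonneg _) hcs i1 i2 i3
  -- The final constant 30 comes from `600 ≤ 30²`.
  have fin : ∀ y : EuclideanSpace ℝ (Fin d), ‖y‖ ^ 2 ≤ 600 * ε → ‖y‖ ≤ 30 * √ε := by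
    intro y hy
    refine abs_le_of_sq_le_sq' ?_ (by positivity) |>.2
    rw [mul_pow, Real.sq_sqrt hε.le]
    linarith
  rcases le_total 0 c with hc | hc
  · left
    apply fin
    rw [norm_sub_sq_real, hz, ← hcdef]
    rw [abs_of_nonneg hc] at key
    linarith
  · right
    apply fin
    rw [sub_neg_eq_add, norm_add_sq_real, hz, ← hcdef]
    rw [abs_of_nonpos hc] at key
    linarith

theorem mainTheorem1 :
    ∃ C : ℝ, 0 < C ∧ ∀ k : ℕ, ∃ P : MvPolynomial (Fin 2) ℝ,
      ∀ (d : ℕ) (μ ε : ℝ) (z : EuclideanSpace ℝ (Fin d)) (p : unitInterval),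
        0 < ε →
        ‖z‖ = 1 →
        ‖z.ofLp‖ ≤ μ / √(d : ℝ) →
        MvPolynomial.eval ![μ, Real.log d] P / (d * ε ^ 2) ≤ (p : ℝ) →
        1 - 1 / (d : ℝ) ^ k ≤ (observationLaw d p).real
          {S | ∀ x ∈ incoherentBall d μ,
            IsLocalMin
              (completionObjective (observedEntries S) (Matrix.vecMulVec z.ofLp z.ofLp)) x →
            ‖x - z‖ ≤ C * √ε ∨ ‖x - (-z)‖ ≤ C * √ε} := by
  -- With `η = ε/(16μ⁴)`, the condition `8 (2 + k log d) ≤ η² p d` needs the factor `8 · 16² = 2048`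
  -- and `μ⁸`.
  refine ⟨30, by norm_num, fun k => ⟨.C 2048 * .X 0 ^ 8 * (.C 2 + .C (k : ℝ) * .X 1), ?_⟩⟩
  intro d μ ε z p hε hz hzμ hP
  have hprob : IsProbabilityMeasure (observationLaw d p) := by
    unfold observationLaw; infer_instance
  have hd : 1 ≤ d := by
    rcases Nat.eq_zero_or_pos d with rfl | h
    · have : z = 0 := Subsingleton.elim _ _
      simp [this] at hz
    · exact h
  have hd0 : (0 : ℝ) < d := by exact_mod_cast hd
  have hd1 : (1 : ℝ) ≤ d := by exact_mod_cast hd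
  have hsd : 0 < √(d : ℝ) := Real.sqrt_pos.2 hd0
  have hsq : √(d : ℝ) ^ 2 = d := Real.sq_sqrt hd0.le
  have hμ0 : 0 ≤ μ := by
    have := (norm_nonneg _).trans hzμ
    rwa [le_div_iff₀ hsd, zero_mul] at this
  have hnorm : ∀ (y : EuclideanSpace ℝ (Fin d)) (r : ℝ), 0 ≤ r → ‖y.ofLp‖ ≤ r / √(d : ℝ) →
      ‖y‖ ≤ r := by
    intro y r hr hy
    refine abs_le_of_sq_le_sq' ?_ hr |>.2
    rw [EuclideanSpace.real_norm_sq_eq]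
    refine (Finset.sum_le_card_nsmul _ _ ((r / √(d : ℝ)) ^ 2) fun i _ => ?_).trans_eq ?_
    · rw [← sq_abs]
      exact pow_le_pow_left₀ (abs_nonneg _) ((norm_le_pi_norm y.ofLp i).trans hy) 2
    · rw [div_pow, hsq]
      simp
      field_simp
  have hμ1 : 1 ≤ μ := hz ▸ hnorm z μ hμ0 hzμ
  -- If `ε ≥ μ²`, every `x` in the ball has `‖x - z‖ ≤ 2μ + 1 ≤ 3√ε`. Otherwise `η ≤ 2`, as the tail
  -- bound requires.
  rcases le_or_gt (μ ^ 2) ε with hbig | hsmall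
  · refine le_trans (b := 1) (by simp) (le_of_eq ?_)
    rw [← probReal_univ (μ := observationLaw d p)]
    congr 1
    refine (Set.eq_univ_of_forall fun S x hx _ => Or.inl ?_).symm
    have h1 : ‖x‖ ≤ 2 * μ := hnorm x (2 * μ) (by positivity) (le_of_lt hx)
    have h2 : μ ≤ √ε := Real.le_sqrt_of_sq_le hbig
    have h3 := norm_sub_le x z
    linarith
  · have hL : 0 ≤ (k : ℝ) * Real.log d := mul_nonneg k.cast_nonneg (Real.log_nonneg hd1)
    simp only [map_mul, map_pow, map_add, MvPolynomial.eval_C, MvPolynomial.eval_X,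
      Matrix.cons_val_zero, Matrix.cons_val_one] at hP
    have hp : 0 < (p : ℝ) := lt_of_lt_of_le (by positivity) hP
    rw [div_le_iff₀ (by positivity)] at hP
    have hη2 : ε / (16 * μ ^ 4) ≤ 2 := by
      rw [div_le_iff₀ (by positivity)]
      have : μ ^ 2 ≤ μ ^ 4 := pow_le_pow_right₀ hμ1 (by norm_num)
      linarith [sq_nonneg μ]
    have hη : 8 * (2 + k * Real.log d) ≤ (ε / (16 * μ ^ 4)) ^ 2 * p * d := by
      rw [div_pow, div_mul_eq_mul_div, div_mul_eq_mul_div, le_div_iff₀ (by positivity)]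
      linarith
    refine (obsDeviation_uniform hd p (by positivity) hη2 hη).trans (measureReal_mono ?_)
    intro S hS x hx hmin
    refine close_of_isLocalMin (m := 2 * μ / √(d : ℝ)) hε hp hz (fun i => ?_) (fun i => ?_)
      (fun a b ha hb => ?_) hmin
    · refine ((norm_le_pi_norm z.ofLp i).trans hzμ).trans ?_
      gcongr
      linarith
    · exact (norm_le_pi_norm x.ofLp i).trans (le_of_lt hx)
    · refine (abs_obsDeviation_le hS (by positivity) ha hb).trans_eq ?_
      rw [div_pow, hsq]
      field_simp
      ring
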